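/- Let $\mathcal Q$ be the set of qubit channels, i.e. completely positive trace-preserving linear maps on $M_2(\mathbb C)$. It is a compact convex set; its relative interior $\mathrm{ri}(\mathcal Q)$ is its interior in its affine hull, and $\partial\mathcal Q=\mathcal Q\setminus \mathrm{ri}(\mathcal Q)$. For $\mathcal F\in\mathcal Q$ define the boundariness $$b(\mathcal F)=1-\sup\,\max_j \pi_j ,$$ where the supremum is over all finite convex decompositions $\mathcal F=\sum_j\pi_j\mathcal E_j$ with all $\mathcal E_j\in\partial\mathcal Q$. Let $J_{\mathcal F}=(\mathcal F\otimes\mathcal I)[\Psi_+]$ with $\Psi_+=\tfrac12\sum_{j,k}|jj\rangle\langle kk|$ be the Choi–Jamiołkowski operator, let $|U\rangle\!\rangle=(U\otimes I)\sum_j|jj\rangle$, and let $\|\cdot\|_{\mathcal Q}$ be the base norm of $\mathcal Q$, $\|\Phi\|_{\mathcal Q}=\sup\{f(\Phi): f \text{ real linear},\ |f|\le 1\text{ on }\mathcal Q\}$ for $\Phi$ in the real linear span of $\mathcal Q$. Let $$W=\frac1{\sqrt2}\begin{pmatrix}0&0&1&i\\-1&i&0&0\\1&i&0&0\\0&0&1&-i\end{pmatrix}$$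 (the magic basis matrix, with rows ordered $|00\rangle,|01\rangle,|10\rangle,|11\rangle$), which is unitary. Theorem. Let $\mathcal F\in\mathrm{ri}(\mathcal Q)$. Then $J_{\mathcal F}$ is invertible, $R=W^\dagger J_{\mathcal F}^{-1}W+(W^\dagger J_{\mathcal F}^{-1}W)^T$ is a real symmetric matrix whose largest eigenvalue $\lambda_1(R)$ is positive, and $$b(\mathcal F)=\frac{2}{\lambda_1(R)} .$$ Moreover $\|\mathcal F-\mathcal E\|_{\mathcal Q}\le 2(1-b(\mathcal F))$ for every channel $\mathcal E\in\mathcal Q$. For every real unit eigenvector $v$ of $R$ for the eigenvalue $\lambda_1(R)$ there is a unitary $U$ with $|U\rangle\!\rangle=\sqrt2\,Wv$, and the unitary channel $\mathcal U:\rho\mapsto U\rho U^\dagger$ satisfies $\|\mathcal F-\mathcal U\|_{\mathcal Q}=2(1-b(\mathcal F))$. Conversely, if $U$ is a unitary whose channel $\mathcal U$ satisfies this equality, then $|U\rangle\!\rangle=c\sqrt2\,Wv$ for some $c\in\mathbb C$ with $|c|=1$ and some real unit eigenvector $v$ of $R$ for $\lambda_1(R)$. -/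

import Mathlib

open scoped Matrix ComplexOrder Kronecker

noncomputable section

namespace QuantumChannel

section ConvexSets

variable {V : Type*} [AddCommGroup V] [Module ℝ V] [TopologicalSpace V]

/-- The boundary `∂B = B \ ri(B)` of a compact convex set `B`, where `ri(B)` is the relative
interior, i.e. the interior of `B` in its affine hull. -/
def boundary (B : Set V) : Set V := B \ intrinsicInterior ℝ B

/-- `w` is the maximal weight of some finite convex decomposition `y = ∑ j, π j • x j`
into boundary points `x j ∈ ∂B`. -/
def IsMaxBoundaryWeight (B : Set V) (y : V) (w : ℝ) : Prop :=
  ∃ (m : ℕ) (π : Fin m → ℝ) (x : Fin m → V),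
    (∀ j, 0 ≤ π j) ∧ ∑ j, π j = 1 ∧ (∀ j, x j ∈ boundary B) ∧ ∑ j, π j • x j = y ∧
      IsGreatest (Set.range π) w

/-- The boundariness `b(y) = 1 - sup w`, the supremum running over the maximal weights `w` of all
convex decompositions of `y` into boundary points of `B`. -/
def boundariness (B : Set V) (y : V) : ℝ := 1 - sSup {w : ℝ | IsMaxBoundaryWeight B y w}

end ConvexSets

/-- The base norm of `v` with respect to a base `B`: the norm dual to the order unit norm,
`‖v‖_B = sup {⟨f, v⟩ : ‖f‖_e ≤ 1}`. Here `e` is the functional equal to `1` on `B`, so that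
`‖f‖_e ≤ 1` (that is, `e ± f` is positive on the cone generated by `B`) says `|f| ≤ 1` on `B`. -/
def baseNorm {V : Type*} [AddCommGroup V] [Module ℝ V] (B : Set V) (v : V) : ℝ :=
  sSup {r : ℝ | ∃ f : V →ₗ[ℝ] ℝ, (∀ z ∈ B, |f z| ≤ 1) ∧ f v = r}

/-- Linear maps on complex `n × n` matrices. They are all continuous, and the space
`→L[ℂ]` carries its (unique Hausdorff) vector space topology. -/
abbrev MatrixMap (n : Type*) [Fintype n] [DecidableEq n] : Type _ :=
  Matrix n n ℂ →L[ℂ] Matrix n n ℂ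

section Channels

variable {n : Type*} [Fintype n] [DecidableEq n]

/-- The map `Φ ⊗ id` applied to an operator `X` on `ℂⁿ ⊗ ℂᵏ`: `Φ` acts on every block of `X`. -/
def ampliation {k : Type*} (Φ : MatrixMap n) (X : Matrix (n × k) (n × k) ℂ) :
    Matrix (n × k) (n × k) ℂ :=
  Matrix.of fun p q => Φ (Matrix.of fun i j => X (i, p.2) (j, q.2)) p.1 q.1

/-- Complete positivity: every `Φ ⊗ id_k` preserves positive semidefiniteness. -/
def IsCompletelyPositive (Φ : MatrixMap n) : Prop :=
  ∀ (k : ℕ) (X : Matrix (n × Fin k) (n × Fin k) ℂ), X.PosSemidef → (ampliation Φ X).PosSemidef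

variable (n) in
/-- The set of quantum channels: completely positive trace-preserving maps. -/
def channels : Set (MatrixMap n) :=
  {Φ | IsCompletelyPositive Φ ∧ ∀ ρ : Matrix n n ℂ, (Φ ρ).trace = ρ.trace}

variable (n) in
/-- The unnormalized vector `∑ j, |jj⟩`. -/
def sumDiag : n × n → ℂ := fun p => if p.1 = p.2 then 1 else 0

variable (n) in
/-- The projection `Ψ₊ = (1/d) ∑ j k, |jj⟩⟨kk|`. -/
def psiPlus : Matrix (n × n) (n × n) ℂ :=
  ((Fintype.card n : ℂ)⁻¹) • Matrix.vecMulVec (sumDiag n) (star (sumDiag n))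

/-- The Choi–Jamiołkowski operator `J_Φ = (Φ ⊗ id)(Ψ₊)`. -/
def choi (Φ : MatrixMap n) : Matrix (n × n) (n × n) ℂ := ampliation Φ (psiPlus n)

/-- The vector `|U⟩⟩ = (U ⊗ I) ∑ j, |jj⟩`. -/
def vectorize (U : Matrix n n ℂ) : n × n → ℂ :=
  (U ⊗ₖ (1 : Matrix n n ℂ)) *ᵥ sumDiag n

/-- The map `ρ ↦ U ρ U†`. -/
def conjMap (U : Matrix n n ℂ) : MatrixMap n where
  toFun ρ := U * ρ * Uᴴ
  map_add' ρ σ := by rw [mul_add, add_mul]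
  map_smul' c ρ := by simp
  cont := by fun_prop

end Channels

/-- The magic basis matrix; its rows are indexed by the product basis of `ℂ² ⊗ ℂ²` in the order
`|00⟩, |01⟩, |10⟩, |11⟩`. -/
def magicW : Matrix (Fin 2 × Fin 2) (Fin 4) ℂ :=
  (((Real.sqrt 2 : ℝ) : ℂ)⁻¹) •
    (!![0, 0, 1, Complex.I;
        -1, Complex.I, 0, 0;
        1, Complex.I, 0, 0;
        0, 0, 1, -Complex.I] : Matrix (Fin 4) (Fin 4) ℂ).submatrix finProdFinEquiv id

/-- The set of (real) eigenvalues of a real square matrix. -/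
def realEigenvalues {m : Type*} [Fintype m] [DecidableEq m] (A : Matrix m m ℝ) : Set ℝ :=
  {μ | Module.End.HasEigenvalue (Matrix.toLin' A) μ}

/-- The largest eigenvalue `λ₁` of a real symmetric matrix. -/
def lambda1 {m : Type*} [Fintype m] [DecidableEq m] (A : Matrix m m ℝ) : ℝ :=
  sSup (realEigenvalues A)

/-- `v` is a leading unit eigenvector of `A`: a real unit vector with `A v = λ₁ v`. -/
def IsLeadingUnitEigenvector {m : Type*} [Fintype m] [DecidableEq m] (A : Matrix m m ℝ)
    (v : m → ℝ) : Prop :=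
  v ⬝ᵥ v = 1 ∧ A *ᵥ v = lambda1 A • v

/-- The vector `√2 W v` of `ℂ² ⊗ ℂ²`, for a real vector `v`. -/
def magicVector (v : Fin 4 → ℝ) : Fin 2 × Fin 2 → ℂ :=
  ((Real.sqrt 2 : ℝ) : ℂ) • (magicW *ᵥ fun i => ((v i : ℝ) : ℂ))

end QuantumChannel

end

open QuantumChannel

/-!
In dimension `d`, `F = t E + (1 - t) G` for some channel `G` exactly when the Choi operators satisfy
`J_F ≥ t J_E`. For a unitary channel `J_U` is the rank one operator `|U⟩⟩⟨⟨U| / d`, so by the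
Cauchy–Schwarz inequality the largest such `t` is `d / ⟨⟨U|J_F⁻¹|U⟩⟩`. The polar decomposition
shows that no channel does worse than the worst unitary one: the weight
`b = d / max_U ⟨⟨U|J_F⁻¹|U⟩⟩` is available to every channel `E`. If a channel `E` had a weight
larger than `1 - b` in `F`, then splitting the remainder once more would exhibit `E` as a convex
combination of `F` and another channel with a positive coefficient at `F`, so `E` would not lie on
the boundary. The optimal unitary channel and its complement in `F` do lie on the boundary and have
the weights `b` and `1 - b`; hence the boundariness is `b`.

Since `F - E = (1 - b) (G - E)`, the base norm of `F - E` is at most `2 (1 - b)`. For an optimal `U`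
the functional `Φ ↦ ⟨x|J_Φ|x⟩` with `x = J_F⁻¹|U⟩⟩` is maximal at the unitary channel and vanishes
at its complement in `F`, which makes the bound sharp; for any other `U` a larger weight is
available and the bound is strict.

In dimension two a unitary is, up to a phase, an element of `SU(2)`, that is, a unit quaternion, and
`|U⟩⟩ = √2 W v` with `v` a real unit vector. The maximum of `⟨⟨U|J_F⁻¹|U⟩⟩` is thus the maximum of a
Rayleigh quotient of the real symmetric matrix `R`.
-/

noncomputable section

namespace QuantumChannel

open Topology

section ConvexSets

variable {V : Type*} [AddCommGroup V] [Module ℝ V] {B : Set V} {x y g : V} {t b w : ℝ}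

section RelativeInterior

variable [TopologicalSpace V]

theorem mem_intrinsicInterior_iff_mem_nhdsWithin :
    y ∈ intrinsicInterior ℝ B ↔ y ∈ affineSpan ℝ B ∧ B ∈ 𝓝[(affineSpan ℝ B : Set V)] y := by
  rw [mem_intrinsicInterior]
  constructor
  · rintro ⟨z, hz, rfl⟩
    exact ⟨z.2, preimage_coe_mem_nhds_subtype.1 (mem_interior_iff_mem_nhds.1 hz)⟩
  · rintro ⟨hy, hB⟩
    exact ⟨⟨y, hy⟩, mem_interior_iff_mem_nhds.2 (preimage_coe_mem_nhds_subtype.2 hB), rfl⟩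

variable [IsTopologicalAddGroup V] [ContinuousSMul ℝ V]

theorem exists_pos_add_smul_sub_mem (hy : y ∈ intrinsicInterior ℝ B) (hx : x ∈ B) :
    ∃ ε : ℝ, 0 < ε ∧ y + ε • (y - x) ∈ B := by
  obtain ⟨hyA, hB⟩ := mem_intrinsicInterior_iff_mem_nhdsWithin.1 hy
  have hcont : Continuous fun ε : ℝ => y + ε • (y - x) := by fun_prop
  have hlim : Filter.Tendsto (fun ε : ℝ => y + ε • (y - x)) (𝓝 0)
      (𝓝[(affineSpan ℝ B : Set V)] y) := by
    refine tendsto_nhdsWithin_iff.2 ⟨?_, .of_forall fun ε => ?_⟩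
    · simpa using hcont.tendsto 0
    · simpa [add_comm] using
        (affineSpan ℝ B).smul_vsub_vadd_mem ε hyA (subset_affineSpan ℝ B hx) hyA
  have hmem := (hlim.eventually hB).filter_mono (nhdsWithin_le_nhds (s := Set.Ioi 0))
  obtain ⟨ε, hεB, hε⟩ := (hmem.and self_mem_nhdsWithin).exists
  exact ⟨ε, hε, hεB⟩

theorem map_pos_of_mem_intrinsicInterior (hy : y ∈ intrinsicInterior ℝ B) {φ : V →ₗ[ℝ] ℝ}
    (hφ : ∀ z ∈ B, 0 ≤ φ z) (hx : x ∈ B) (hφx : 0 < φ x) : 0 < φ y := by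
  obtain ⟨ε, hε, hmem⟩ := exists_pos_add_smul_sub_mem hy hx
  have hnonneg := hφ _ hmem
  rw [map_add, map_smul, map_sub, smul_eq_mul] at hnonneg
  nlinarith [mul_pos hε hφx]

theorem smul_add_smul_mem_intrinsicInterior (hB : Convex ℝ B) (hy : y ∈ intrinsicInterior ℝ B)
    (hx : x ∈ B) (ht : 0 < t) (ht1 : t ≤ 1) : t • y + (1 - t) • x ∈ intrinsicInterior ℝ B := by
  obtain ⟨hyA, hBy⟩ := mem_intrinsicInterior_iff_mem_nhdsWithin.1 hy
  have hxA := subset_affineSpan ℝ B hx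
  have hcombo {z : V} (hz : z ∈ B) : t • z + (1 - t) • x ∈ B :=
    hB hz hx ht.le (sub_nonneg.2 ht1) (add_sub_cancel t 1)
  have hmem := subset_affineSpan ℝ B (hcombo (mem_of_mem_nhdsWithin hyA hBy))
  refine mem_intrinsicInterior_iff_mem_nhdsWithin.2 ⟨hmem, ?_⟩
  -- Pull the neighbourhood `B` of `y` back along the inverse of `z ↦ t • z + (1 - t) • x`.
  have hcont : Continuous fun z : V => x + t⁻¹ • (z - x) := by fun_prop
  have hinv : x + t⁻¹ • (t • y + (1 - t) • x - x) = y := by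
    rw [show t • y + (1 - t) • x - x = t • (y - x) by module, inv_smul_smul₀ ht.ne',
      add_sub_cancel]
  have hlim : Filter.Tendsto (fun z : V => x + t⁻¹ • (z - x))
      (𝓝[(affineSpan ℝ B : Set V)] (t • y + (1 - t) • x)) (𝓝[(affineSpan ℝ B : Set V)] y) := by
    refine tendsto_nhdsWithin_iff.2 ⟨?_, ?_⟩
    · simpa only [hinv] using
        (hcont.tendsto (t • y + (1 - t) • x)).mono_left nhdsWithin_le_nhds
    · filter_upwards [self_mem_nhdsWithin] with z hz
      simpa [add_comm] using (affineSpan ℝ B).smul_vsub_vadd_mem t⁻¹ hz hxA hxA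
  filter_upwards [hlim.eventually hBy] with z hz
  convert hcombo hz using 1
  rw [smul_add, smul_inv_smul₀ ht.ne']
  module

end RelativeInterior

/-- The point `x` occurs with weight `t` in the point `y` of the convex set `B`: it is a term with
coefficient `t` of a convex decomposition of `y`, the other terms being collected into one `g`. -/
def HasWeight (B : Set V) (t : ℝ) (x y : V) : Prop :=
  t ≤ 1 ∧ ∃ g ∈ B, y = t • x + (1 - t) • g

theorem hasWeight_sum {ι : Type*} [Fintype ι] (hB : Convex ℝ B) {π : ι → ℝ} {x : ι → V}
    (h0 : ∀ j, 0 ≤ π j) (h1 : ∑ j, π j = 1) (hx : ∀ j, x j ∈ B) (j : ι) :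
    HasWeight B (π j) (x j) (∑ i, π i • x i) := by
  classical
  have hrest : 1 - π j = ∑ i ∈ Finset.univ.erase j, π i := by
    rw [← h1, ← Finset.add_sum_erase _ _ (Finset.mem_univ j), add_sub_cancel_left]
  have hnonneg : ∀ i ∈ Finset.univ.erase j, 0 ≤ π i := fun i _ => h0 i
  refine ⟨sub_nonneg.1 (hrest ▸ Finset.sum_nonneg hnonneg), ?_⟩
  rw [← Finset.add_sum_erase _ _ (Finset.mem_univ j), hrest]
  rcases (Finset.sum_nonneg hnonneg).eq_or_lt' with hzero | hpos
  · refine ⟨x j, hx j, ?_⟩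
    rw [hzero, zero_smul, Finset.sum_eq_zero fun i hi => by
      rw [(Finset.sum_eq_zero_iff_of_nonneg hnonneg).1 hzero i hi, zero_smul]]
  · refine ⟨(Finset.univ.erase j).centerMass π x,
      hB.centerMass_mem hnonneg hpos fun i _ => hx i, ?_⟩
    rw [Finset.centerMass, smul_inv_smul₀ hpos.ne']

theorem HasWeight.lt_one (h : HasWeight B t x y) (hxy : x ≠ y) : t < 1 := by
  obtain ⟨ht, g, -, rfl⟩ := h
  refine ht.lt_of_ne ?_
  rintro rfl
  simp at hxy

theorem HasWeight.mul_map_le (h : HasWeight B t x y) {φ : V →ₗ[ℝ] ℝ} (hφ : ∀ z ∈ B, 0 ≤ φ z) :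
    t * φ x ≤ φ y := by
  obtain ⟨ht, g, hg, rfl⟩ := h
  simpa using mul_nonneg (sub_nonneg.2 ht) (hφ g hg)

section Boundariness

variable [TopologicalSpace V]

theorem isMaxBoundaryWeight_max (ht : 0 ≤ t) (ht1 : t ≤ 1) (hx : x ∈ boundary B)
    (hg : g ∈ boundary B) (hy : y = t • x + (1 - t) • g) :
    IsMaxBoundaryWeight B y (max t (1 - t)) := by
  refine ⟨2, ![t, 1 - t], ![x, g], ?_, by simp, ?_, by simp [hy], ?_⟩
  · simp [Fin.forall_fin_two, ht, ht1]
  · simp [Fin.forall_fin_two, hx, hg]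
  · simpa [Set.pair_comm] using isGreatest_pair (a := t) (b := 1 - t)

variable [IsTopologicalAddGroup V] [ContinuousSMul ℝ V]

theorem HasWeight.mem_intrinsicInterior (hB : Convex ℝ B) (hy : y ∈ intrinsicInterior ℝ B)
    (hb : 0 < b) (hweight : ∀ z ∈ B, HasWeight B b z y) (hx : HasWeight B w x y)
    (hw : 1 - b < w) : x ∈ intrinsicInterior ℝ B := by
  obtain ⟨hw1, z, hz, hyz⟩ := hx
  obtain ⟨hb1, g, hg, hyg⟩ := hweight z hz
  have hbw : 0 < b * w := mul_pos hb (by linarith)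
  -- Eliminating `z` from the two decompositions of `y` exhibits `x` as a convex combination of
  -- `y` and `g`.
  have hcombo : (b * w) • x = (b - 1 + w) • y + (b * w - (b - 1 + w)) • g := by
    linear_combination (norm := module) (1 - w) • hyg - b • hyz
  have hx : x = ((b - 1 + w) / (b * w)) • y + (1 - (b - 1 + w) / (b * w)) • g := by
    rw [← inv_smul_smul₀ hbw.ne' x, hcombo, smul_add, smul_smul, smul_smul, mul_sub,
      inv_mul_cancel₀ hbw.ne', div_eq_inv_mul]
  rw [hx]
  refine smul_add_smul_mem_intrinsicInterior hB hy hg (div_pos (by linarith) hbw) ?_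
  rw [div_le_one hbw]
  nlinarith

theorem IsMaxBoundaryWeight.le_one_sub (hB : Convex ℝ B) (hy : y ∈ intrinsicInterior ℝ B)
    (hb : 0 < b) (hweight : ∀ z ∈ B, HasWeight B b z y) (hw : IsMaxBoundaryWeight B y w) :
    w ≤ 1 - b := by
  obtain ⟨m, π, x, h0, h1, hx, rfl, ⟨j, rfl⟩, -⟩ := hw
  by_contra! hlt
  exact (hx j).2 <|
    (hasWeight_sum hB h0 h1 (fun i => (hx i).1) j).mem_intrinsicInterior hB hy hb hweight hlt

theorem boundariness_eq (hB : Convex ℝ B) (hy : y ∈ intrinsicInterior ℝ B) (hb : 0 < b)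
    (hweight : ∀ z ∈ B, HasWeight B b z y) (hx : x ∈ boundary B) (hg : g ∈ boundary B)
    (hyxg : y = b • x + (1 - b) • g) : boundariness B y = b := by
  have hle (w : ℝ) (hw : IsMaxBoundaryWeight B y w) : w ≤ 1 - b :=
    hw.le_one_sub hB hy hb hweight
  have hmem := isMaxBoundaryWeight_max hb.le (hweight x hx.1).1 hx hg hyxg
  rw [(le_max_right b (1 - b)).antisymm' (hle _ hmem)] at hmem
  have hgreatest : IsGreatest {w | IsMaxBoundaryWeight B y w} (1 - b) := ⟨hmem, hle⟩
  rw [boundariness, hgreatest.csSup_eq, sub_sub_cancel]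

end Boundariness

theorem HasWeight.map_sub_le (h : HasWeight B t x y) (hx : x ∈ B) {f : V →ₗ[ℝ] ℝ}
    (hf : ∀ z ∈ B, |f z| ≤ 1) : f (y - x) ≤ 2 * (1 - t) := by
  obtain ⟨ht, g, hg, rfl⟩ := h
  rw [show t • x + (1 - t) • g - x = (1 - t) • (g - x) by module, map_smul, map_sub, smul_eq_mul]
  nlinarith [(abs_le.1 (hf x hx)).1, (abs_le.1 (hf g hg)).2]

theorem HasWeight.baseNorm_sub_le (h : HasWeight B t x y) (hx : x ∈ B) :
    baseNorm B (y - x) ≤ 2 * (1 - t) := by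
  refine Real.sSup_le ?_ (by linarith [h.1])
  rintro _ ⟨f, hf, rfl⟩
  exact h.map_sub_le hx hf

theorem baseNorm_sub_eq_of_separating (ht : t ≤ 1) (hx : x ∈ B) (hg : g ∈ B)
    (hy : y = t • x + (1 - t) • g) {f : V →ₗ[ℝ] ℝ} (hf : ∀ z ∈ B, |f z| ≤ 1) (hfx : f x = -1)
    (hfg : f g = 1) : baseNorm B (y - x) = 2 * (1 - t) := by
  have hweight : HasWeight B t x y := ⟨ht, g, hg, hy⟩
  refine (hweight.baseNorm_sub_le hx).antisymm (le_csSup ⟨2 * (1 - t), ?_⟩ ⟨f, hf, ?_⟩)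
  · rintro _ ⟨f, hf, rfl⟩
    exact hweight.map_sub_le hx hf
  · rw [hy, show t • x + (1 - t) • g - x = (1 - t) • (g - x) by module, map_smul, map_sub, hfx,
      hfg, smul_eq_mul]
    ring

/-- A positive functional `φ` vanishing at the complement `g` of `x` is maximal at `x`, because
every `z ∈ B` occurs in `y` with the weight of `x`; so `e - (2 / φ x) • φ` separates `x` and `g`. -/
theorem baseNorm_sub_eq_of_map_eq_zero (hb : 0 < b) (hweight : ∀ z ∈ B, HasWeight B b z y)
    (hx : x ∈ B) (hg : g ∈ B) (hyxg : y = b • x + (1 - b) • g) {e φ : V →ₗ[ℝ] ℝ}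
    (he : ∀ z ∈ B, e z = 1) (hφ : ∀ z ∈ B, 0 ≤ φ z) (hφy : 0 < φ y) (hφg : φ g = 0) :
    baseNorm B (y - x) = 2 * (1 - b) := by
  have hyx : φ y = b * φ x := by
    rw [hyxg, map_add, map_smul, map_smul, hφg, smul_zero, add_zero, smul_eq_mul]
  have hφx : 0 < φ x := pos_of_mul_pos_right (hyx ▸ hφy) hb.le
  have hmax {z : V} (hz : z ∈ B) : φ z ≤ φ x :=
    le_of_mul_le_mul_left (hyx ▸ (hweight z hz).mul_map_le hφ) hb
  refine baseNorm_sub_eq_of_separating (f := e - (2 / φ x) • φ) (hweight x hx).1 hx hg hyxg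
    (fun z hz => ?_) ?_ ?_
  · have hle : φ z / φ x ≤ 1 := (div_le_one hφx).2 (hmax hz)
    have hnonneg : 0 ≤ φ z / φ x := div_nonneg (hφ z hz) hφx.le
    have hval : (e - (2 / φ x) • φ) z = 1 - 2 * (φ z / φ x) := by
      simp [he z hz, div_mul_eq_mul_div, mul_div_assoc]
    rw [hval, abs_le]
    constructor <;> linarith
  · simp only [LinearMap.sub_apply, LinearMap.smul_apply, smul_eq_mul, he x hx,
      div_mul_cancel₀ 2 hφx.ne']
    norm_num
  · simp [he g hg, hφg]

end ConvexSets

section QuadraticForms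

variable {𝕜 n : Type*} [RCLike 𝕜] [Fintype n]

/-- The expectation value `⟨x|K|x⟩` of the Hermitian matrix `K` in the unnormalized state `x`; the
real part only serves to make it a real number. -/
def quadForm (K : Matrix n n 𝕜) (x : n → 𝕜) : ℝ := RCLike.re (star x ⬝ᵥ K *ᵥ x)

theorem quadForm_add (K L : Matrix n n 𝕜) (x : n → 𝕜) :
    quadForm (K + L) x = quadForm K x + quadForm L x := by
  simp only [quadForm, Matrix.add_mulVec, dotProduct_add, map_add]

theorem quadForm_sub (K L : Matrix n n 𝕜) (x : n → 𝕜) :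
    quadForm (K - L) x = quadForm K x - quadForm L x := by
  simp only [quadForm, Matrix.sub_mulVec, dotProduct_sub, map_sub]

theorem quadForm_smul (r : ℝ) (K : Matrix n n 𝕜) (x : n → 𝕜) :
    quadForm (r • K) x = r * quadForm K x := by
  simp only [quadForm, Matrix.smul_mulVec, dotProduct_smul, RCLike.smul_re]

theorem quadForm_sum {ι : Type*} (s : Finset ι) (K : ι → Matrix n n 𝕜) (x : n → 𝕜) :
    quadForm (∑ i ∈ s, K i) x = ∑ i ∈ s, quadForm (K i) x := by
  simp only [quadForm, Matrix.sum_mulVec, dotProduct_sum, map_sum]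

theorem quadForm_apply_smul (K : Matrix n n 𝕜) (c : 𝕜) (x : n → 𝕜) :
    quadForm K (c • x) = ‖c‖ ^ 2 * quadForm K x := by
  rw [quadForm, Matrix.mulVec_smul, star_smul, smul_dotProduct, dotProduct_smul, smul_smul,
    RCLike.star_def, RCLike.conj_mul, ← RCLike.ofReal_pow, smul_eq_mul, RCLike.re_ofReal_mul,
    quadForm]

theorem quadForm_mulVec {m : Type*} [Fintype m] (K : Matrix n n 𝕜) (A : Matrix n m 𝕜)
    (x : m → 𝕜) : quadForm K (A *ᵥ x) = quadForm (Aᴴ * K * A) x := by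
  rw [quadForm, quadForm, Matrix.star_mulVec, ← Matrix.dotProduct_mulVec, Matrix.mulVec_mulVec,
    Matrix.mulVec_mulVec, Matrix.mul_assoc]

theorem quadForm_ofReal (K : Matrix n n 𝕜) (v : n → ℝ) :
    quadForm K (fun i => (v i : 𝕜)) = v ⬝ᵥ K.map RCLike.re *ᵥ v := by
  simp [quadForm, dotProduct, Matrix.mulVec, mul_comm]

theorem quadForm_vecMulVec (u x : n → 𝕜) :
    quadForm (Matrix.vecMulVec u (star u)) x = ‖star u ⬝ᵥ x‖ ^ 2 := by
  have hconj : star x ⬝ᵥ u = star (star u ⬝ᵥ x) := Matrix.star_dotProduct ..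
  rw [quadForm, Matrix.vecMulVec_mulVec, dotProduct_smul, hconj, op_smul_eq_mul,
    RCLike.star_def, RCLike.conj_mul, ← RCLike.ofReal_pow, RCLike.ofReal_re]

theorem continuous_quadForm (K : Matrix n n 𝕜) : Continuous (quadForm K) := by
  unfold quadForm
  fun_prop

theorem posSemidef_iff_quadForm_nonneg {K : Matrix n n 𝕜} :
    K.PosSemidef ↔ K.IsHermitian ∧ ∀ x, 0 ≤ quadForm K x := by
  refine ⟨fun hK => ⟨hK.isHermitian, hK.re_dotProduct_nonneg⟩, fun ⟨hK, hnonneg⟩ => ?_⟩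
  refine .of_dotProduct_mulVec_nonneg hK fun x => RCLike.nonneg_iff.2 ⟨hnonneg x, ?_⟩
  exact hK.im_star_dotProduct_mulVec_self x

theorem norm_sq_dotProduct_mulVec_le {K : Matrix n n 𝕜} (hK : K.PosSemidef) (x y : n → 𝕜) :
    ‖star x ⬝ᵥ K *ᵥ y‖ ^ 2 ≤ quadForm K x * quadForm K y := by
  let := K.toSeminormedAddCommGroup hK
  let := K.toInnerProductSpace hK
  have hinner (u v : n → 𝕜) : inner 𝕜 u v = star u ⬝ᵥ K *ᵥ v := dotProduct_comm _ _
  simpa only [sq, quadForm, ← hinner, norm_inner_symm x y] using inner_mul_inner_self_le x y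

theorem norm_sq_trace_mul_le {P : Matrix n n 𝕜} (hP : P.PosSemidef) (K L : Matrix n n 𝕜) :
    ‖(K * P * Lᴴ).trace‖ ^ 2 ≤ RCLike.re (K * P * Kᴴ).trace * RCLike.re (L * P * Lᴴ).trace := by
  let := P.toMatrixSeminormedAddCommGroup hP
  let := P.toMatrixInnerProductSpace hP
  have hinner (A B : Matrix n n 𝕜) : inner 𝕜 A B = (B * P * Aᴴ).trace := rfl
  simpa only [sq, ← hinner, norm_inner_symm L K] using inner_mul_inner_self_le (𝕜 := 𝕜) K L

variable [DecidableEq n] {K : Matrix n n 𝕜}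

theorem star_inv_mulVec_dotProduct_mulVec (hK : K.PosDef) (x y : n → 𝕜) :
    star (K⁻¹ *ᵥ x) ⬝ᵥ K *ᵥ y = star x ⬝ᵥ y := by
  rw [Matrix.star_mulVec, hK.inv.isHermitian.eq, ← Matrix.dotProduct_mulVec, Matrix.mulVec_mulVec,
    Matrix.nonsing_inv_mul _ ((Matrix.isUnit_iff_isUnit_det _).1 hK.isUnit), Matrix.one_mulVec]

theorem quadForm_inv_mulVec (hK : K.PosDef) (x : n → 𝕜) :
    quadForm K (K⁻¹ *ᵥ x) = quadForm K⁻¹ x := by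
  rw [quadForm, star_inv_mulVec_dotProduct_mulVec hK, quadForm]

theorem norm_sq_dotProduct_le_quadForm_inv_mul (hK : K.PosDef) (x y : n → 𝕜) :
    ‖star x ⬝ᵥ y‖ ^ 2 ≤ quadForm K⁻¹ x * quadForm K y := by
  simpa only [star_inv_mulVec_dotProduct_mulVec hK, quadForm_inv_mulVec hK] using
    norm_sq_dotProduct_mulVec_le hK.posSemidef (K⁻¹ *ᵥ x) y

end QuadraticForms

section PolarDecomposition

variable {𝕜 n : Type*} [RCLike 𝕜] [Fintype n] [DecidableEq n]

open scoped MatrixOrder in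
theorem exists_unitary_mul_posSemidef {A : Matrix n n 𝕜} (hA : A.det ≠ 0) :
    ∃ U ∈ Matrix.unitaryGroup n 𝕜, ∃ P : Matrix n n 𝕜, P.PosSemidef ∧ A = U * P := by
  set P := CFC.sqrt (Aᴴ * A)
  have hP : P.PosSemidef := Matrix.nonneg_iff_posSemidef.1 (CFC.sqrt_nonneg _)
  have hPP : P * P = Aᴴ * A :=
    CFC.sqrt_mul_sqrt_self _ (Matrix.posSemidef_conjTranspose_mul_self A).nonneg
  have hdet : IsUnit P.det := by
    refine isUnit_iff_ne_zero.2 fun h0 => hA ?_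
    simpa [h0] using congrArg Matrix.det hPP
  refine ⟨A * P⁻¹, ?_, P, hP, by rw [mul_assoc, Matrix.nonsing_inv_mul _ hdet, mul_one]⟩
  rw [Matrix.mem_unitaryGroup_iff', Matrix.star_eq_conjTranspose, Matrix.conjTranspose_mul,
    Matrix.conjTranspose_nonsing_inv, hP.isHermitian.eq, mul_assoc, ← mul_assoc Aᴴ, ← hPP,
    mul_assoc P, Matrix.mul_nonsing_inv _ hdet, mul_one, Matrix.nonsing_inv_mul _ hdet]

theorem eventually_det_add_smul_one_ne_zero (A : Matrix n n 𝕜) :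
    ∀ᶠ t : 𝕜 in 𝓝[≠] 0, (A + t • (1 : Matrix n n 𝕜)).det ≠ 0 := by
  have hfinite : {t : 𝕜 | (-A).charpoly.IsRoot t}.Finite :=
    Polynomial.finite_setOfPred_isRoot (Matrix.charpoly_monic _).ne_zero
  filter_upwards [nhdsNE_le_cofinite _ hfinite.compl_mem_cofinite] with t ht hdet
  refine ht ?_
  rw [Set.mem_ofPred_eq, Polynomial.IsRoot, Matrix.eval_charpoly, sub_neg_eq_add, add_comm, ← hdet,
    Matrix.smul_one_eq_diagonal]
  rfl

end PolarDecomposition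

section Choi

variable {n : Type*} [Fintype n] [DecidableEq n] {Φ : MatrixMap n}

theorem choi_apply (Φ : MatrixMap n) (p q : n × n) :
    choi Φ p q = (Fintype.card n : ℂ)⁻¹ * Φ (Matrix.single p.2 q.2 1) p.1 q.1 := by
  have hblock : (Matrix.of fun i j => psiPlus n (i, p.2) (j, q.2)) =
      (Fintype.card n : ℂ)⁻¹ • Matrix.single p.2 q.2 (1 : ℂ) := by
    ext i j
    by_cases hi : i = p.2 <;> by_cases hj : j = q.2 <;>
      simp [psiPlus, sumDiag, Matrix.vecMulVec_apply, hi, hj, eq_comm]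
  rw [choi, ampliation, Matrix.of_apply, hblock, map_smul, Matrix.smul_apply, smul_eq_mul]

theorem choi_add (Φ Ψ : MatrixMap n) : choi (Φ + Ψ) = choi Φ + choi Ψ := rfl

theorem choi_smul (r : ℝ) (Φ : MatrixMap n) : choi (r • Φ) = r • choi Φ := rfl

theorem choi_sum {ι : Type*} (s : Finset ι) (Φ : ι → MatrixMap n) :
    choi (∑ a ∈ s, Φ a) = ∑ a ∈ s, choi (Φ a) := by
  ext p q
  simp only [choi_apply, sum_apply, Matrix.sum_apply, Finset.mul_sum]

theorem apply_eq_sum_choi (Φ : MatrixMap n) (ρ : Matrix n n ℂ) (i j : n) :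
    Φ ρ i j = (Fintype.card n : ℂ) * ∑ k, ∑ l, ρ k l * choi Φ (i, k) (j, l) := by
  have : Nonempty n := ⟨i⟩
  have hcard : (Fintype.card n : ℂ) ≠ 0 := Nat.cast_ne_zero.2 Fintype.card_ne_zero
  have hsingle (k l : n) : Φ (Matrix.single k l (ρ k l)) = ρ k l • Φ (Matrix.single k l 1) := by
    rw [← map_smul, Matrix.smul_single, smul_eq_mul, mul_one]
  conv_lhs => rw [Matrix.matrix_eq_sum_single ρ]
  simp only [map_sum, Matrix.sum_apply, hsingle, Matrix.smul_apply, smul_eq_mul, choi_apply,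
    Finset.mul_sum, mul_left_comm, mul_inv_cancel_left₀ hcard]

theorem choi_injective : Function.Injective (choi : MatrixMap n → _) := by
  intro Φ Ψ h
  ext ρ i j
  rw [apply_eq_sum_choi, apply_eq_sum_choi, h]

theorem posSemidef_psiPlus : (psiPlus n).PosSemidef :=
  (Matrix.posSemidef_vecMulVec_self_star _).smul (by positivity)

theorem IsCompletelyPositive.posSemidef_choi (h : IsCompletelyPositive Φ) :
    (choi Φ).PosSemidef := by
  -- Complete positivity is stated for the ancillas `Fin k` only.
  let e : n × Fin (Fintype.card n) ≃ n × n := (Equiv.refl n).prodCongr (Fintype.equivFin n).symm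
  have hampliation : ampliation Φ ((psiPlus n).submatrix e e) = (choi Φ).submatrix e e := rfl
  rw [← Matrix.posSemidef_submatrix_equiv e, ← hampliation]
  exact h _ _ (posSemidef_psiPlus.submatrix e)

/-- The partial trace over the first tensor factor. -/
def partialTrace {R m k : Type*} [Semiring R] [Fintype m] :
    Matrix (m × k) (m × k) R →ₗ[R] Matrix k k R where
  toFun J := Matrix.of fun p q => ∑ i, J (i, p) (i, q)
  map_add' J K := by ext; simp [Finset.sum_add_distrib]
  map_smul' r J := by ext; simp [Finset.mul_sum]

theorem trace_partialTrace {R m k : Type*} [Semiring R] [Fintype m] [Fintype k]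
    (J : Matrix (m × k) (m × k) R) : (partialTrace J).trace = J.trace := by
  simp only [partialTrace, LinearMap.coe_mk, AddHom.coe_mk, Matrix.trace, Matrix.diag_apply,
    Matrix.of_apply, Fintype.sum_prod_type_right]

theorem partialTrace_choi (h : ∀ ρ : Matrix n n ℂ, (Φ ρ).trace = ρ.trace) :
    partialTrace (choi Φ) = (Fintype.card n : ℝ)⁻¹ • (1 : Matrix n n ℂ) := by
  ext k l
  have hentry : partialTrace (choi Φ) k l =
      (Fintype.card n : ℂ)⁻¹ * (Φ (Matrix.single k l 1)).trace := by
    simp [partialTrace, choi_apply, Matrix.trace, Finset.mul_sum]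
  rw [hentry, h]
  by_cases hkl : k = l
  · subst hkl; simp
  · simp [Matrix.trace_single_eq_of_ne _ _ _ hkl, hkl]

theorem trace_choi [Nonempty n] (h : ∀ ρ : Matrix n n ℂ, (Φ ρ).trace = ρ.trace) :
    (choi Φ).trace = 1 := by
  rw [← trace_partialTrace, partialTrace_choi h, Matrix.trace_smul, Matrix.trace_one]
  simp

theorem vectorize_eq_vec (U : Matrix n n ℂ) : vectorize U = Matrix.vec Uᵀ := by
  ext p
  simp [vectorize, Matrix.mulVec, dotProduct, sumDiag, Fintype.sum_prod_type, Matrix.one_apply,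
    Matrix.kroneckerMap_apply]

theorem vectorize_apply (U : Matrix n n ℂ) (p : n × n) : vectorize U p = U p.1 p.2 := by
  rw [vectorize_eq_vec, Matrix.vec, Matrix.transpose_apply]

theorem vectorize_bijective : Function.Bijective (vectorize : Matrix n n ℂ → n × n → ℂ) := by
  rw [show (vectorize : Matrix n n ℂ → _) = Matrix.vec ∘ Matrix.transpose from
    funext vectorize_eq_vec]
  exact Matrix.vec_bijective.comp (Matrix.transposeAddEquiv n n ℂ).bijective

theorem vectorize_ne_zero {A : Matrix n n ℂ} (hA : A ≠ 0) : vectorize A ≠ 0 := by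
  rwa [vectorize_eq_vec, Ne, Matrix.vec_eq_zero_iff, Matrix.transpose_eq_zero]

theorem vectorize_add_smul (A C : Matrix n n ℂ) (t : ℂ) :
    vectorize (A + t • C) = vectorize A + t • vectorize C := by
  simp only [vectorize_eq_vec, Matrix.transpose_add, Matrix.transpose_smul, Matrix.vec_add,
    Matrix.vec_smul]

theorem star_vectorize_dotProduct (A K : Matrix n n ℂ) :
    star (vectorize A) ⬝ᵥ vectorize K = (Aᴴ * K).trace := by
  rw [vectorize_eq_vec, vectorize_eq_vec, Matrix.star_vec_dotProduct_vec,
    Matrix.conjTranspose_transpose_eq_transpose_conjTranspose, ← Matrix.transpose_mul,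
    Matrix.trace_transpose, Matrix.trace_mul_comm]

theorem partialTrace_vecMulVec_vectorize (K : Matrix n n ℂ) :
    partialTrace (Matrix.vecMulVec (vectorize K) (star (vectorize K))) = (Kᴴ * K)ᵀ := by
  ext k l
  simp [partialTrace, Matrix.vecMulVec_apply, vectorize_apply, Matrix.mul_apply, mul_comm]

theorem choi_conjMap (U : Matrix n n ℂ) : choi (conjMap U) =
    (Fintype.card n : ℝ)⁻¹ • Matrix.vecMulVec (vectorize U) (star (vectorize U)) := by
  ext p q
  rw [choi_apply]
  simp [conjMap, Matrix.vecMulVec_apply, vectorize_apply, Matrix.mul_apply, Matrix.single_apply,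
    ite_and]

theorem quadForm_choi_conjMap (U : Matrix n n ℂ) (x : n × n → ℂ) :
    quadForm (choi (conjMap U)) x =
      (Fintype.card n : ℝ)⁻¹ * ‖star (vectorize U) ⬝ᵥ x‖ ^ 2 := by
  rw [choi_conjMap, quadForm_smul, quadForm_vecMulVec]

theorem exists_eq_sum_conjMap (h : (choi Φ).PosSemidef) :
    ∃ (m : ℕ) (K : Fin m → Matrix n n ℂ), Φ = (Fintype.card n : ℝ) • ∑ a, conjMap (K a) := by
  obtain ⟨m, v, hv⟩ := Matrix.posSemidef_iff_eq_sum_vecMulVec.1 h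
  choose K hK using fun a => vectorize_bijective.surjective (v a)
  refine ⟨m, K, choi_injective (Matrix.ext fun p q => ?_)⟩
  have : Nonempty n := ⟨p.1⟩
  have hcard : (Fintype.card n : ℝ) ≠ 0 := Nat.cast_ne_zero.2 Fintype.card_ne_zero
  simp only [choi_smul, choi_sum, choi_conjMap, ← Finset.smul_sum, hK, smul_inv_smul₀ hcard, hv]

theorem ampliation_conjMap {k : Type*} [Fintype k] [DecidableEq k] (U : Matrix n n ℂ)
    (X : Matrix (n × k) (n × k) ℂ) :
    ampliation (conjMap U) X = (U ⊗ₖ (1 : Matrix k k ℂ)) * X * (U ⊗ₖ (1 : Matrix k k ℂ))ᴴ := by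
  ext p q
  rw [Matrix.conjTranspose_kronecker, Matrix.conjTranspose_one]
  simp [ampliation, conjMap, Matrix.mul_apply, Fintype.sum_prod_type, Matrix.kroneckerMap_apply,
    Matrix.one_apply, Finset.sum_mul]

theorem isCompletelyPositive_conjMap (U : Matrix n n ℂ) : IsCompletelyPositive (conjMap U) := by
  intro k X hX
  rw [ampliation_conjMap]
  exact hX.mul_mul_conjTranspose_same _

theorem IsCompletelyPositive.smul {r : ℝ} (hr : 0 ≤ r) (h : IsCompletelyPositive Φ) :
    IsCompletelyPositive (r • Φ) := fun k X hX => (h k X hX).smul hr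

theorem IsCompletelyPositive.sum {ι : Type*} {s : Finset ι} {Φ : ι → MatrixMap n}
    (h : ∀ a ∈ s, IsCompletelyPositive (Φ a)) : IsCompletelyPositive (∑ a ∈ s, Φ a) := by
  intro k X hX
  have hsum : ampliation (∑ a ∈ s, Φ a) X = ∑ a ∈ s, ampliation (Φ a) X := by
    ext p q
    simp only [ampliation, Matrix.of_apply, sum_apply, Matrix.sum_apply]
  rw [hsum]
  exact Matrix.posSemidef_sum s fun a ha => h a ha k X hX

theorem isCompletelyPositive_iff_posSemidef_choi :
    IsCompletelyPositive Φ ↔ (choi Φ).PosSemidef := by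
  refine ⟨IsCompletelyPositive.posSemidef_choi, fun h => ?_⟩
  obtain ⟨m, K, rfl⟩ := exists_eq_sum_conjMap h
  exact .smul (Nat.cast_nonneg _) (.sum fun a _ => isCompletelyPositive_conjMap (K a))

end Choi

section Channels

variable {n : Type*} [Fintype n] [DecidableEq n] {E F G : MatrixMap n} {t : ℝ}

theorem conjMap_mem_channels {U : Matrix n n ℂ} (hU : U ∈ Matrix.unitaryGroup n ℂ) :
    conjMap U ∈ channels n := by
  refine ⟨isCompletelyPositive_conjMap U, fun ρ => ?_⟩
  change (U * ρ * Uᴴ).trace = ρ.trace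
  rw [Matrix.trace_mul_comm, ← mul_assoc, ← Matrix.star_eq_conjTranspose,
    Matrix.mem_unitaryGroup_iff'.1 hU, one_mul]

theorem convex_channels : Convex ℝ (channels n) := by
  rintro E ⟨hE, hEtr⟩ F ⟨hF, hFtr⟩ a b ha hb hab
  refine ⟨?_, fun ρ => ?_⟩
  · rw [isCompletelyPositive_iff_posSemidef_choi] at hE hF ⊢
    exact (hE.smul ha).add (hF.smul hb)
  · rw [add_apply, smul_apply, smul_apply, Matrix.trace_add, Matrix.trace_smul, Matrix.trace_smul,
      hEtr, hFtr, ← add_smul, hab, one_smul]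

theorem hasWeight_channels_iff [Nonempty n] (hE : E ∈ channels n) (hF : F ∈ channels n) :
    HasWeight (channels n) t E F ↔ (choi F - t • choi E).PosSemidef := by
  constructor
  · rintro ⟨ht, G, hG, rfl⟩
    rw [choi_add, choi_smul, choi_smul, add_sub_cancel_left]
    exact hG.1.posSemidef_choi.smul (sub_nonneg.2 ht)
  · intro h
    have htrace : (choi F - t • choi E).trace = ((1 - t : ℝ) : ℂ) := by
      simp [Matrix.trace_sub, Matrix.trace_smul, trace_choi hE.2, trace_choi hF.2]
    have ht : 0 ≤ 1 - t := by exact_mod_cast htrace ▸ h.trace_nonneg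
    refine ⟨sub_nonneg.1 ht, ?_⟩
    rcases ht.eq_or_lt' with ht1 | hlt
    · refine ⟨E, hE, choi_injective ?_⟩
      have hzero := h.trace_eq_zero_iff.1 (by rw [htrace, ht1, Complex.ofReal_zero])
      rw [sub_eq_zero] at hzero
      rw [← add_smul, add_sub_cancel, one_smul, hzero, ← sub_eq_zero.1 ht1, one_smul]
    · refine ⟨(1 - t)⁻¹ • (F - t • E), ⟨?_, fun ρ => ?_⟩, ?_⟩
      · exact isCompletelyPositive_iff_posSemidef_choi.2 (h.smul (inv_nonneg.2 ht))
      · rw [smul_apply, sub_apply, smul_apply, Matrix.trace_smul, Matrix.trace_sub,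
          Matrix.trace_smul, hE.2, hF.2, inv_smul_eq_iff₀ hlt.ne', sub_smul, one_smul]
      · rw [smul_inv_smul₀ hlt.ne', add_sub_cancel]

variable (n) in
/-- The completely depolarizing channel `ρ ↦ (tr ρ / d) I`. -/
def depolarizing : MatrixMap n where
  toFun ρ := ((Fintype.card n : ℂ)⁻¹ * ρ.trace) • 1
  map_add' ρ σ := by rw [Matrix.trace_add, mul_add, add_smul]
  map_smul' c ρ := by simp [smul_smul, mul_left_comm]
  cont := by fun_prop

theorem choi_depolarizing : choi (depolarizing n) = ((Fintype.card n : ℝ)⁻¹ ^ 2) • 1 := by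
  ext p q
  have happly (ρ : Matrix n n ℂ) :
    depolarizing n ρ = ((Fintype.card n : ℂ)⁻¹ * ρ.trace) • 1 := rfl
  rw [choi_apply, happly]
  by_cases hpq : p.2 = q.2
  · simp [hpq, Matrix.one_apply, Prod.ext_iff, sq]
  · simp [Matrix.trace_single_eq_of_ne _ _ _ hpq, Matrix.one_apply, Prod.ext_iff, hpq]

theorem depolarizing_mem_channels [Nonempty n] : depolarizing n ∈ channels n := by
  refine ⟨?_, fun ρ => ?_⟩
  · rw [isCompletelyPositive_iff_posSemidef_choi, choi_depolarizing]
    exact Matrix.PosSemidef.one.smul (by positivity)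
  · change (((Fintype.card n : ℂ)⁻¹ * ρ.trace) • (1 : Matrix n n ℂ)).trace = ρ.trace
    rw [Matrix.trace_smul, Matrix.trace_one, smul_eq_mul, mul_right_comm,
      inv_mul_cancel₀ (Nat.cast_ne_zero.2 Fintype.card_ne_zero), one_mul]

/-- The functional `Φ ↦ ⟨x|J_Φ|x⟩`. -/
def choiExpectation (x : n × n → ℂ) : MatrixMap n →ₗ[ℝ] ℝ where
  toFun Φ := quadForm (choi Φ) x
  map_add' Φ Ψ := by rw [choi_add, quadForm_add]
  map_smul' r Φ := by rw [choi_smul, quadForm_smul, RingHom.id_apply, smul_eq_mul]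

theorem choiExpectation_apply (x : n × n → ℂ) (Φ : MatrixMap n) :
    choiExpectation x Φ = quadForm (choi Φ) x := rfl

theorem choiExpectation_nonneg (hE : E ∈ channels n) (x : n × n → ℂ) : 0 ≤ choiExpectation x E :=
  (posSemidef_iff_quadForm_nonneg.1 hE.1.posSemidef_choi).2 x

variable (n) in
/-- The functional `Φ ↦ tr J_Φ`, which is `1` on channels; on maps that do not preserve
Hermiticity the trace need not be real, and its real part is taken. -/
def choiTrace : MatrixMap n →ₗ[ℝ] ℝ where
  toFun Φ := (choi Φ).trace.re
  map_add' Φ Ψ := by rw [choi_add, Matrix.trace_add, Complex.add_re]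
  map_smul' r Φ := by rw [choi_smul, Matrix.trace_smul, Complex.smul_re, RingHom.id_apply]

theorem choiTrace_eq_one [Nonempty n] (hE : E ∈ channels n) : choiTrace n E = 1 :=
  congrArg Complex.re (trace_choi hE.2)

instance continuousSMul_real_matrixMap : ContinuousSMul ℝ (MatrixMap n) :=
  ⟨show Continuous fun p : ℝ × MatrixMap n => (p.1 : ℂ) • p.2 from
    (Complex.continuous_ofReal.comp continuous_fst).smul continuous_snd⟩

theorem choi_posDef [Nonempty n] (hF : F ∈ intrinsicInterior ℝ (channels n)) :
    (choi F).PosDef := by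
  refine .of_dotProduct_mulVec_pos (intrinsicInterior_subset hF).1.posSemidef_choi.isHermitian
    fun x hx => ?_
  have hdepolarizing : 0 < choiExpectation x (depolarizing n) := by
    have hone : 0 < quadForm (1 : Matrix (n × n) (n × n) ℂ) x :=
      Matrix.PosDef.one.re_dotProduct_pos hx
    rw [choiExpectation_apply, choi_depolarizing, quadForm_smul]
    positivity
  have hpos := map_pos_of_mem_intrinsicInterior hF (fun E hE => choiExpectation_nonneg hE x)
    depolarizing_mem_channels hdepolarizing
  exact Complex.pos_iff.2 ⟨hpos, (Matrix.IsHermitian.im_star_dotProduct_mulVec_self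
    (intrinsicInterior_subset hF).1.posSemidef_choi.isHermitian x).symm⟩

theorem mem_boundary_of_quadForm_choi_eq_zero [Nonempty n] (hG : G ∈ channels n)
    {x : n × n → ℂ} (hx : x ≠ 0) (h : quadForm (choi G) x = 0) : G ∈ boundary (channels n) :=
  ⟨hG, fun hri => ((choi_posDef hri).re_dotProduct_pos hx).ne' h⟩

theorem conjMap_mem_boundary [Nontrivial n] {U : Matrix n n ℂ}
    (hU : U ∈ Matrix.unitaryGroup n ℂ) : conjMap U ∈ boundary (channels n) := by
  obtain ⟨i, j, hij⟩ := exists_pair_ne n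
  have hUU : Uᴴ * U = 1 := Matrix.mem_unitaryGroup_iff'.1 hU
  have hcancel : Uᴴ * (U * Matrix.single i j 1) = Matrix.single i j 1 := by
    rw [← mul_assoc, hUU, one_mul]
  have hne : U * Matrix.single i j 1 ≠ 0 := by
    intro h0
    rw [h0, mul_zero] at hcancel
    simpa using congrFun₂ hcancel i j
  refine mem_boundary_of_quadForm_choi_eq_zero (conjMap_mem_channels hU) (vectorize_ne_zero hne) ?_
  rw [quadForm_choi_conjMap, star_vectorize_dotProduct, hcancel,
    Matrix.trace_single_eq_of_ne _ _ _ hij]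
  simp

end Channels

section Domination

variable {n : Type*} [Fintype n] [DecidableEq n]

theorem norm_sq_star_vectorize_dotProduct_le {U P : Matrix n n ℂ}
    (hU : U ∈ Matrix.unitaryGroup n ℂ) (hP : P.PosSemidef) (K : Matrix n n ℂ) :
    ‖star (vectorize K) ⬝ᵥ vectorize (U * P)‖ ^ 2 ≤ P.trace.re * (Kᴴ * K * P).trace.re := by
  have hUU : U * Uᴴ = 1 := Matrix.mem_unitaryGroup_iff.1 hU
  have hoverlap : star (vectorize K) ⬝ᵥ vectorize (U * P) = (1 * P * (Uᴴ * K)ᴴ).trace := by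
    rw [star_vectorize_dotProduct, ← mul_assoc, Matrix.trace_mul_comm, one_mul,
      Matrix.conjTranspose_mul, Matrix.conjTranspose_conjTranspose]
  have hmarginal : (Kᴴ * K * P).trace = (Uᴴ * K * P * (Uᴴ * K)ᴴ).trace := by
    rw [Matrix.trace_mul_comm _ (Uᴴ * K)ᴴ, Matrix.conjTranspose_mul,
      Matrix.conjTranspose_conjTranspose, mul_assoc Uᴴ, mul_assoc Kᴴ U, ← mul_assoc U, hUU,
      one_mul, mul_assoc]
  rw [hoverlap, hmarginal]
  simpa only [one_mul, mul_one, Matrix.conjTranspose_one, RCLike.re_to_complex] using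
    norm_sq_trace_mul_le hP 1 (Uᴴ * K)

/-- Decompose `E = ∑ |K⟩⟩⟨⟨K|` and apply to each `K` the Cauchy–Schwarz inequality for
`⟨A, B⟩ = tr (A P B†)`; the scalar marginal of `E` is what makes the resulting sum add up. -/
theorem quadForm_vectorize_mul_le {U P : Matrix n n ℂ} (hU : U ∈ Matrix.unitaryGroup n ℂ)
    (hP : P.PosSemidef) {E : Matrix (n × n) (n × n) ℂ} (hE : E.PosSemidef) {c : ℝ}
    (hc : partialTrace E = c • (1 : Matrix n n ℂ)) :
    quadForm E (vectorize (U * P)) ≤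
      c * ‖star (vectorize U) ⬝ᵥ vectorize (U * P)‖ ^ 2 := by
  obtain ⟨m, v, rfl⟩ := Matrix.posSemidef_iff_eq_sum_vecMulVec.1 hE
  choose K hK using fun a => vectorize_bijective.surjective (v a)
  simp only [← hK, map_sum, partialTrace_vecMulVec_vectorize] at hc ⊢
  have hsum : ∑ a, (K a)ᴴ * K a = c • (1 : Matrix n n ℂ) := by
    rw [← Matrix.transpose_sum] at hc
    simpa only [Matrix.transpose_transpose, Matrix.transpose_smul, Matrix.transpose_one] using
      congrArg Matrix.transpose hc
  have hnorm : ‖star (vectorize U) ⬝ᵥ vectorize (U * P)‖ ^ 2 = P.trace.re * P.trace.re := by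
    have hUU : Uᴴ * U = 1 := Matrix.mem_unitaryGroup_iff'.1 hU
    have htrace : ‖P.trace‖ = P.trace.re :=
      congrArg Complex.re (Complex.norm_of_nonneg' hP.trace_nonneg)
    rw [star_vectorize_dotProduct, ← mul_assoc, hUU, one_mul, htrace, sq]
  calc quadForm (∑ a, Matrix.vecMulVec (vectorize (K a)) (star (vectorize (K a))))
        (vectorize (U * P))
      = ∑ a, ‖star (vectorize (K a)) ⬝ᵥ vectorize (U * P)‖ ^ 2 := by
        simp only [quadForm_sum, quadForm_vecMulVec]
    _ ≤ ∑ a, P.trace.re * ((K a)ᴴ * K a * P).trace.re :=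
        Finset.sum_le_sum fun a _ => norm_sq_star_vectorize_dotProduct_le hU hP (K a)
    _ = c * ‖star (vectorize U) ⬝ᵥ vectorize (U * P)‖ ^ 2 := by
        rw [hnorm, ← Finset.mul_sum, ← Complex.re_sum, ← Matrix.trace_sum, ← Finset.sum_mul, hsum,
          Matrix.smul_mul, one_mul, Matrix.trace_smul, Complex.smul_re, smul_eq_mul]
        ring

theorem posSemidef_smul_sub {J E : Matrix (n × n) (n × n) ℂ} (hJ : J.PosDef)
    (hE : E.PosSemidef) {c L : ℝ} (hc0 : 0 ≤ c)
    (hc : partialTrace E = c • (1 : Matrix n n ℂ))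
    (hL : ∀ U ∈ Matrix.unitaryGroup n ℂ, quadForm J⁻¹ (vectorize U) ≤ L) :
    ((c * L) • J - E).PosSemidef := by
  have hinvertible {A : Matrix n n ℂ} (hA : A.det ≠ 0) :
      0 ≤ quadForm ((c * L) • J - E) (vectorize A) := by
    obtain ⟨U, hU, P, hP, rfl⟩ := exists_unitary_mul_posSemidef hA
    have hJnonneg : 0 ≤ quadForm J (vectorize (U * P)) :=
      hJ.posSemidef.re_dotProduct_nonneg _
    rw [quadForm_sub, quadForm_smul, sub_nonneg]
    calc quadForm E (vectorize (U * P))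
        ≤ c * ‖star (vectorize U) ⬝ᵥ vectorize (U * P)‖ ^ 2 := quadForm_vectorize_mul_le hU hP hE hc
      _ ≤ c * (quadForm J⁻¹ (vectorize U) * quadForm J (vectorize (U * P))) := by
          gcongr
          exact norm_sq_dotProduct_le_quadForm_inv_mul hJ _ _
      _ ≤ c * (L * quadForm J (vectorize (U * P))) := by
          gcongr
          exact hL U hU
      _ = c * L * quadForm J (vectorize (U * P)) := by ring
  refine posSemidef_iff_quadForm_nonneg.2
    ⟨(hJ.isHermitian.smul (IsSelfAdjoint.all _)).sub hE.isHermitian, fun x => ?_⟩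
  obtain ⟨A, rfl⟩ := vectorize_bijective.surjective x
  have hcont : Continuous fun t : ℂ => quadForm ((c * L) • J - E) (vectorize (A + t • 1)) := by
    simp only [vectorize_add_smul]
    exact (continuous_quadForm _).comp (by fun_prop)
  have hlim := (hcont.tendsto 0).mono_left (nhdsWithin_le_nhds (s := {0}ᶜ))
  rw [zero_smul, add_zero] at hlim
  exact ge_of_tendsto hlim ((eventually_det_add_smul_one_ne_zero A).mono fun t => hinvertible)

end Domination

section OptimalUnitary

variable {n : Type*} [Fintype n] [DecidableEq n] {E F : MatrixMap n} {U : Matrix n n ℂ}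

/-- A unitary maximizing `⟨⟨V|J_F⁻¹|V⟩⟩` over all unitaries `V`; no channel occurs in `F` with a
smaller maximal weight than its unitary channel. -/
def IsOptimalUnitary (F : MatrixMap n) (U : Matrix n n ℂ) : Prop :=
  U ∈ Matrix.unitaryGroup n ℂ ∧
    IsMaxOn (fun V => quadForm (choi F)⁻¹ (vectorize V)) (Matrix.unitaryGroup n ℂ) U

variable (F U) in
/-- The largest weight with which the unitary channel of `U` occurs in the channel `F`. -/
def unitaryWeight : ℝ := Fintype.card n / quadForm (choi F)⁻¹ (vectorize U)

theorem quadForm_vectorize_pos [Nonempty n] {K : Matrix (n × n) (n × n) ℂ} (hK : K.PosDef)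
    (hU : U ∈ Matrix.unitaryGroup n ℂ) : 0 < quadForm K (vectorize U) := by
  refine hK.re_dotProduct_pos (vectorize_ne_zero ?_)
  rintro rfl
  simpa using Matrix.mem_unitaryGroup_iff.1 hU

theorem unitaryWeight_pos [Nonempty n] (hJ : (choi F).PosDef)
    (hU : U ∈ Matrix.unitaryGroup n ℂ) : 0 < unitaryWeight F U :=
  div_pos (Nat.cast_pos.2 Fintype.card_pos) (quadForm_vectorize_pos hJ.inv hU)

theorem hasWeight_conjMap [Nonempty n] (hF : F ∈ channels n) (hJ : (choi F).PosDef)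
    (hU : U ∈ Matrix.unitaryGroup n ℂ) :
    HasWeight (channels n) (unitaryWeight F U) (conjMap U) F := by
  have hcard : (Fintype.card n : ℝ) ≠ 0 := Nat.cast_ne_zero.2 Fintype.card_ne_zero
  have hq := quadForm_vectorize_pos hJ.inv hU
  rw [hasWeight_channels_iff (conjMap_mem_channels hU) hF, posSemidef_iff_quadForm_nonneg]
  have hHermitian := (conjMap_mem_channels hU).1.posSemidef_choi.isHermitian
  refine ⟨hJ.isHermitian.sub (hHermitian.smul (IsSelfAdjoint.all _)), fun x => ?_⟩
  have hcs := norm_sq_dotProduct_le_quadForm_inv_mul hJ (vectorize U) x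
  rw [quadForm_sub, quadForm_smul, quadForm_choi_conjMap, sub_nonneg, unitaryWeight,
    ← mul_assoc, div_mul_eq_mul_div, mul_inv_cancel₀ hcard, one_div_mul_eq_div, div_le_iff₀' hq]
  exact hcs

theorem IsOptimalUnitary.hasWeight [Nonempty n] (hU : IsOptimalUnitary F U) (hF : F ∈ channels n)
    (hJ : (choi F).PosDef) (hE : E ∈ channels n) :
    HasWeight (channels n) (unitaryWeight F U) E F := by
  have hcard : (Fintype.card n : ℝ) ≠ 0 := Nat.cast_ne_zero.2 Fintype.card_ne_zero
  have hq := quadForm_vectorize_pos hJ.inv hU.1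
  rw [hasWeight_channels_iff hE hF]
  have hdom := (posSemidef_smul_sub hJ hE.1.posSemidef_choi (by positivity)
    (partialTrace_choi hE.2) fun V hV => hU.2 hV).smul (unitaryWeight_pos hJ hU.1).le
  rwa [smul_sub, smul_smul, unitaryWeight, ← div_eq_inv_mul, div_mul_div_cancel₀ hq.ne',
    div_self hcard, one_smul] at hdom

/-- The complement of the unitary channel of `U` in `F` is singular in the direction
`J_F⁻¹|U⟩⟩`, because the Cauchy–Schwarz inequality behind `hasWeight_conjMap` is sharp there. -/
theorem exists_eq_unitaryWeight_smul_conjMap_add [Nontrivial n]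
    (hF : F ∈ intrinsicInterior ℝ (channels n)) (hU : U ∈ Matrix.unitaryGroup n ℂ) :
    ∃ G ∈ channels n, F = unitaryWeight F U • conjMap U + (1 - unitaryWeight F U) • G ∧
      quadForm (choi G) ((choi F)⁻¹ *ᵥ vectorize U) = 0 := by
  have hJ := choi_posDef hF
  have hq := quadForm_vectorize_pos hJ.inv hU
  have hweight := hasWeight_conjMap (intrinsicInterior_subset hF) hJ hU
  have hlt : unitaryWeight F U < 1 := hweight.lt_one fun h => (conjMap_mem_boundary hU).2 (h ▸ hF)
  obtain ⟨-, G, hG, hsplit⟩ := hweight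
  refine ⟨G, hG, hsplit, ?_⟩
  have hoverlap : ‖star (vectorize U) ⬝ᵥ (choi F)⁻¹ *ᵥ vectorize U‖ =
      quadForm (choi F)⁻¹ (vectorize U) :=
    congrArg Complex.re
      (Complex.norm_of_nonneg' (hJ.inv.posSemidef.dotProduct_mulVec_nonneg (vectorize U)))
  have hF_eq := congrArg (choiExpectation ((choi F)⁻¹ *ᵥ vectorize U)) hsplit
  simp only [map_add, map_smul, choiExpectation_apply, quadForm_inv_mulVec hJ,
    quadForm_choi_conjMap, hoverlap, smul_eq_mul] at hF_eq
  have hU_eq : unitaryWeight F U * ((Fintype.card n : ℝ)⁻¹ *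
      quadForm (choi F)⁻¹ (vectorize U) ^ 2) = quadForm (choi F)⁻¹ (vectorize U) := by
    rw [unitaryWeight]
    field_simp
  rw [hU_eq, left_eq_add] at hF_eq
  exact (mul_eq_zero.1 hF_eq).resolve_left (sub_ne_zero.2 hlt.ne')

namespace IsOptimalUnitary

variable [Nontrivial n]

theorem boundariness_eq (hU : IsOptimalUnitary F U)
    (hF : F ∈ intrinsicInterior ℝ (channels n)) :
    boundariness (channels n) F = unitaryWeight F U := by
  have hJ := choi_posDef hF
  obtain ⟨G, hG, hsplit, hzero⟩ := exists_eq_unitaryWeight_smul_conjMap_add hF hU.1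
  have hx : (choi F)⁻¹ *ᵥ vectorize U ≠ 0 := by
    intro h0
    have hq := quadForm_vectorize_pos hJ.inv hU.1
    rw [← quadForm_inv_mulVec hJ, h0] at hq
    simp [quadForm] at hq
  exact QuantumChannel.boundariness_eq convex_channels hF (unitaryWeight_pos hJ hU.1)
    (fun E hE => hU.hasWeight (intrinsicInterior_subset hF) hJ hE) (conjMap_mem_boundary hU.1)
    (mem_boundary_of_quadForm_choi_eq_zero hG hx hzero) hsplit

theorem baseNorm_sub_le (hU : IsOptimalUnitary F U)
    (hF : F ∈ intrinsicInterior ℝ (channels n)) (hE : E ∈ channels n) :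
    baseNorm (channels n) (F - E) ≤ 2 * (1 - boundariness (channels n) F) := by
  rw [hU.boundariness_eq hF]
  exact (hU.hasWeight (intrinsicInterior_subset hF) (choi_posDef hF) hE).baseNorm_sub_le hE

theorem baseNorm_sub_conjMap (hU : IsOptimalUnitary F U)
    (hF : F ∈ intrinsicInterior ℝ (channels n)) :
    baseNorm (channels n) (F - conjMap U) = 2 * (1 - boundariness (channels n) F) := by
  have hJ := choi_posDef hF
  obtain ⟨G, hG, hsplit, hzero⟩ := exists_eq_unitaryWeight_smul_conjMap_add hF hU.1
  rw [hU.boundariness_eq hF]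
  refine baseNorm_sub_eq_of_map_eq_zero (unitaryWeight_pos hJ hU.1)
    (fun E hE => hU.hasWeight (intrinsicInterior_subset hF) hJ hE) (conjMap_mem_channels hU.1) hG
    hsplit (fun E hE => choiTrace_eq_one hE)
    (fun E hE => choiExpectation_nonneg hE ((choi F)⁻¹ *ᵥ vectorize U)) ?_ hzero
  rw [choiExpectation_apply, quadForm_inv_mulVec hJ]
  exact quadForm_vectorize_pos hJ.inv hU.1

theorem of_baseNorm_sub_eq {V : Matrix n n ℂ} (hU : IsOptimalUnitary F U)
    (hF : F ∈ intrinsicInterior ℝ (channels n)) (hV : V ∈ Matrix.unitaryGroup n ℂ)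
    (hnorm : baseNorm (channels n) (F - conjMap V) = 2 * (1 - boundariness (channels n) F)) :
    IsOptimalUnitary F V := by
  have hJ := choi_posDef hF
  have hle := (hasWeight_conjMap (intrinsicInterior_subset hF) hJ hV).baseNorm_sub_le
    (conjMap_mem_channels hV)
  rw [hnorm, hU.boundariness_eq hF] at hle
  have hweight : unitaryWeight F V ≤ unitaryWeight F U := by linarith
  rw [unitaryWeight, unitaryWeight, div_le_div_iff_of_pos_left
    (Nat.cast_pos.2 Fintype.card_pos) (quadForm_vectorize_pos hJ.inv hV)
    (quadForm_vectorize_pos hJ.inv hU.1)] at hweight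
  exact ⟨hV, fun X hX => (hU.2 hX).trans hweight⟩

end IsOptimalUnitary

end OptimalUnitary

section LargestEigenvalue

variable {m : Type*} [Fintype m] [DecidableEq m] {A : Matrix m m ℝ} {v : m → ℝ}

theorem realEigenvalues_eq_spectrum (A : Matrix m m ℝ) : realEigenvalues A = spectrum ℝ A := by
  ext μ
  rw [realEigenvalues, Set.mem_ofPred_eq, Module.End.hasEigenvalue_iff_mem_spectrum,
    Matrix.spectrum_toLin']

variable [Nonempty m]

theorem isGreatest_lambda1 (hA : A.IsHermitian) : IsGreatest (realEigenvalues A) (lambda1 A) := by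
  have hrange : realEigenvalues A = Set.range hA.eigenvalues := by
    rw [realEigenvalues_eq_spectrum, hA.spectrum_real_eq_range_eigenvalues]
  have hfinite : (realEigenvalues A).Finite := hrange ▸ Set.finite_range _
  have hnonempty : (realEigenvalues A).Nonempty := hrange ▸ Set.range_nonempty _
  exact ⟨hnonempty.csSup_mem hfinite, fun μ hμ => le_csSup hfinite.bddAbove hμ⟩

theorem posSemidef_lambda1_smul_one_sub (hA : A.IsHermitian) :
    (lambda1 A • (1 : Matrix m m ℝ) - A).PosSemidef := by
  rw [Matrix.posSemidef_iff_isHermitian_and_spectrum_nonneg]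
  refine ⟨(Matrix.isHermitian_one.smul (IsSelfAdjoint.all _)).sub hA, ?_⟩
  rw [← Algebra.algebraMap_eq_smul_one, ← spectrum.singleton_sub_eq]
  rintro _ ⟨_, rfl, μ, hμ, rfl⟩
  rw [← realEigenvalues_eq_spectrum] at hμ
  exact sub_nonneg.2 ((isGreatest_lambda1 hA).2 hμ)

theorem dotProduct_mulVec_le_lambda1 (hA : A.IsHermitian) (hv : v ⬝ᵥ v = 1) :
    v ⬝ᵥ A *ᵥ v ≤ lambda1 A := by
  have hnonneg := (posSemidef_lambda1_smul_one_sub hA).dotProduct_mulVec_nonneg v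
  simpa [Matrix.sub_mulVec, Matrix.smul_mulVec, hv] using hnonneg

theorem isLeadingUnitEigenvector_iff (hA : A.IsHermitian) :
    IsLeadingUnitEigenvector A v ↔ v ⬝ᵥ v = 1 ∧ v ⬝ᵥ A *ᵥ v = lambda1 A := by
  refine and_congr_right fun hv => ⟨fun h => ?_, fun h => ?_⟩
  · rw [h, dotProduct_smul, hv, smul_eq_mul, mul_one]
  · have hkernel := ((posSemidef_lambda1_smul_one_sub hA).dotProduct_mulVec_zero_iff v).1
      (by simp [Matrix.sub_mulVec, Matrix.smul_mulVec, hv, h])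
    rw [Matrix.sub_mulVec, Matrix.smul_mulVec, Matrix.one_mulVec, sub_eq_zero] at hkernel
    exact hkernel.symm

theorem exists_isLeadingUnitEigenvector (hA : A.IsHermitian) :
    ∃ v, IsLeadingUnitEigenvector A v := by
  obtain ⟨w, hw⟩ := (isGreatest_lambda1 hA).1.exists_hasEigenvector
  have hpos : 0 < w ⬝ᵥ w := by
    simpa using Matrix.dotProduct_star_self_pos_iff.2 hw.2
  refine ⟨(Real.sqrt (w ⬝ᵥ w))⁻¹ • w, ?_, ?_⟩
  · rw [smul_dotProduct, dotProduct_smul, smul_eq_mul, smul_eq_mul, ← mul_assoc, ← mul_inv,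
      Real.mul_self_sqrt hpos.le, inv_mul_cancel₀ hpos.ne']
  · rw [Matrix.mulVec_smul, smul_comm]
    exact congrArg _ (by simpa using hw.apply_eq_smul)

end LargestEigenvalue

section SpecialUnitary

variable {n : Type*} [Fintype n] [DecidableEq n]

theorem exists_eq_smul_mem_specialUnitaryGroup [Nonempty n] {U : Matrix n n ℂ}
    (hU : U ∈ Matrix.unitaryGroup n ℂ) :
    ∃ c : ℂ, ‖c‖ = 1 ∧ ∃ V ∈ Matrix.specialUnitaryGroup n ℂ, U = c • V := by
  obtain ⟨c, hc⟩ := IsAlgClosed.exists_pow_nat_eq U.det (Fintype.card_pos (α := n))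
  have hnorm : ‖c‖ = 1 := by
    rw [← pow_eq_one_iff_of_nonneg (norm_nonneg c) (Fintype.card_ne_zero (α := n)), ← norm_pow,
      hc]
    exact CStarRing.norm_of_mem_unitary (Matrix.det_of_mem_unitary hU)
  have hc0 : c ≠ 0 := norm_ne_zero_iff.1 (hnorm ▸ one_ne_zero)
  refine ⟨c, hnorm, c⁻¹ • U, Matrix.mem_specialUnitaryGroup_iff.2 ⟨?_, ?_⟩,
    (smul_inv_smul₀ hc0 U).symm⟩
  · have hcc : c⁻¹ * star c⁻¹ = 1 := by
      rw [RCLike.star_def, RCLike.mul_conj, norm_inv, hnorm]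
      simp
    rw [Matrix.mem_unitaryGroup_iff, star_smul, smul_mul_smul_comm, hcc, one_smul,
      Matrix.mem_unitaryGroup_iff.1 hU]
  · rw [Matrix.det_smul, ← hc, ← mul_pow, inv_mul_cancel₀ hc0, one_pow]

theorem adjugate_eq_conjTranspose {V : Matrix n n ℂ} (hV : V ∈ Matrix.specialUnitaryGroup n ℂ) :
    V.adjugate = Vᴴ := by
  obtain ⟨hunitary, hdet⟩ := Matrix.mem_specialUnitaryGroup_iff.1 hV
  calc V.adjugate = V.adjugate * (V * Vᴴ) := by
        rw [← Matrix.star_eq_conjTranspose, Matrix.mem_unitaryGroup_iff.1 hunitary, mul_one]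
    _ = Vᴴ := by rw [← mul_assoc, Matrix.adjugate_mul, hdet, one_smul, one_mul]

end SpecialUnitary

section MagicBasis

theorem magicW_apply (i j : Fin 2) (k : Fin 4) : magicW (i, j) k =
    ((Real.sqrt 2 : ℝ) : ℂ)⁻¹ * (!![![0, 0, 1, Complex.I], ![-1, Complex.I, 0, 0];
      ![1, Complex.I, 0, 0], ![0, 0, 1, -Complex.I]] :
      Matrix (Fin 2) (Fin 2) (Fin 4 → ℂ)) i j k := by
  fin_cases i <;> fin_cases j <;> rfl

theorem ofReal_sqrt_two_ne_zero : ((Real.sqrt 2 : ℝ) : ℂ) ≠ 0 := by simp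

theorem inv_ofReal_sqrt_two_mul_self :
    ((Real.sqrt 2 : ℝ) : ℂ)⁻¹ * ((Real.sqrt 2 : ℝ) : ℂ)⁻¹ = 2⁻¹ := by
  rw [← mul_inv, ← Complex.ofReal_mul, Real.mul_self_sqrt zero_le_two, Complex.ofReal_ofNat]

theorem conjTranspose_magicW_mul_self : magicWᴴ * magicW = 1 := by
  have hstar : star ((Real.sqrt 2 : ℝ) : ℂ)⁻¹ = ((Real.sqrt 2 : ℝ) : ℂ)⁻¹ := by simp
  have hsq := inv_ofReal_sqrt_two_mul_self
  have hI := Complex.I_mul_I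
  ext k l
  simp only [Matrix.mul_apply, Fintype.sum_prod_type, Matrix.conjTranspose_apply, magicW_apply,
    Fin.sum_univ_two, star_mul', hstar]
  generalize ((Real.sqrt 2 : ℝ) : ℂ)⁻¹ = c at *
  fin_cases k <;> fin_cases l <;>
    simp only [Fin.isValue, Fin.zero_eta, Fin.mk_one, Fin.reduceFinMk, Matrix.of_apply,
      Matrix.cons_val, Matrix.cons_val_zero, Matrix.cons_val_one, Matrix.one_apply, star_zero,
      star_one, star_neg, RCLike.star_def, Complex.conj_I] <;>
    grind

theorem magicW_mul_conjTranspose_self : magicW * magicWᴴ = 1 :=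
  (Matrix.mul_eq_one_comm_of_equiv finProdFinEquiv.symm).1 conjTranspose_magicW_mul_self

/-- The unitary `U` with `|U⟩⟩ = √2 W v`: up to signs, the coordinates of `v` are those of the
quaternion that corresponds to `U` in `SU(2)`. -/
def magicUnitary (v : Fin 4 → ℝ) : Matrix (Fin 2) (Fin 2) ℂ :=
  !![(v 2 : ℂ) + v 3 * Complex.I, -(v 0 : ℂ) + v 1 * Complex.I;
    (v 0 : ℂ) + v 1 * Complex.I, (v 2 : ℂ) - v 3 * Complex.I]

theorem vectorize_magicUnitary (v : Fin 4 → ℝ) : vectorize (magicUnitary v) = magicVector v := by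
  ext ⟨i, j⟩
  rw [vectorize_apply, magicVector, Pi.smul_apply, Matrix.mulVec, dotProduct]
  simp only [magicW_apply, mul_assoc, ← Finset.mul_sum, smul_eq_mul]
  rw [mul_inv_cancel_left₀ ofReal_sqrt_two_ne_zero]
  fin_cases i <;> fin_cases j <;> simp [magicUnitary, Fin.sum_univ_four] <;> ring

theorem magicUnitary_mem_unitaryGroup {v : Fin 4 → ℝ} (hv : v ⬝ᵥ v = 1) :
    magicUnitary v ∈ Matrix.unitaryGroup (Fin 2) ℂ := by
  have hcoords : v 0 * v 0 + v 1 * v 1 + v 2 * v 2 + v 3 * v 3 = 1 := by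
    simpa [dotProduct, Fin.sum_univ_four] using hv
  rw [Matrix.mem_unitaryGroup_iff, Matrix.star_eq_conjTranspose]
  ext i j
  fin_cases i <;> fin_cases j <;>
    simp [magicUnitary, Matrix.mul_apply, Complex.ext_iff] <;> constructor <;> linarith

theorem exists_eq_magicUnitary {V : Matrix (Fin 2) (Fin 2) ℂ}
    (hV : V ∈ Matrix.specialUnitaryGroup (Fin 2) ℂ) :
    ∃ v : Fin 4 → ℝ, v ⬝ᵥ v = 1 ∧ V = magicUnitary v := by
  have hadjugate := adjugate_eq_conjTranspose hV
  rw [Matrix.adjugate_fin_two] at hadjugate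
  have h11 : V 1 1 = star (V 0 0) := by simpa using congrFun₂ hadjugate 0 0
  have h01 : V 0 1 = -star (V 1 0) := by simpa [neg_eq_iff_eq_neg] using congrFun₂ hadjugate 0 1
  refine ⟨![(V 1 0).re, (V 1 0).im, (V 0 0).re, (V 0 0).im], ?_, ?_⟩
  · have hdet := congrArg Complex.re (Matrix.mem_specialUnitaryGroup_iff.1 hV).2
    rw [Matrix.det_fin_two, h11, h01] at hdet
    simp [dotProduct, Fin.sum_univ_four] at hdet ⊢
    linarith
  · ext i j
    fin_cases i <;> fin_cases j <;> simp [magicUnitary, h11, h01, Complex.ext_iff]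

/-- The real symmetric matrix `W† K W + (W† K W)ᵀ` for Hermitian `K`; taking the real part makes
its entries real numbers. -/
def magicSymm (K : Matrix (Fin 2 × Fin 2) (Fin 2 × Fin 2) ℂ) : Matrix (Fin 4) (Fin 4) ℝ :=
  (magicWᴴ * K * magicW + (magicWᴴ * K * magicW)ᵀ).map Complex.re

variable {K : Matrix (Fin 2 × Fin 2) (Fin 2 × Fin 2) ℂ}

theorem map_ofReal_magicSymm (hK : K.IsHermitian) :
    (magicSymm K).map (fun r : ℝ => (r : ℂ)) =
      magicWᴴ * K * magicW + (magicWᴴ * K * magicW)ᵀ := by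
  ext i j
  have hij := (Matrix.isHermitian_conjTranspose_mul_mul magicW hK).apply i j
  simp only [magicSymm, Matrix.map_apply, Matrix.add_apply, Matrix.transpose_apply, ← hij]
  simp [Complex.ext_iff]

theorem isSymm_magicSymm : (magicSymm K).IsSymm := by
  rw [magicSymm, Matrix.IsSymm, ← Matrix.transpose_map, Matrix.transpose_add,
    Matrix.transpose_transpose, add_comm]

theorem isHermitian_magicSymm : (magicSymm K).IsHermitian := by
  rw [Matrix.IsHermitian, Matrix.conjTranspose_eq_transpose_of_trivial]
  exact isSymm_magicSymm

theorem quadForm_magicVector (K : Matrix (Fin 2 × Fin 2) (Fin 2 × Fin 2) ℂ) (v : Fin 4 → ℝ) :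
    quadForm K (magicVector v) = v ⬝ᵥ magicSymm K *ᵥ v := by
  have hnorm : ‖((Real.sqrt 2 : ℝ) : ℂ)‖ ^ 2 = 2 := by simp
  set M := (magicWᴴ * K * magicW).map Complex.re
  have hM : magicSymm K = M + Mᵀ := by
    ext i j
    simp only [magicSymm, M, Matrix.map_apply, Matrix.add_apply, Matrix.transpose_apply,
      Complex.add_re]
  have hreal : quadForm (magicWᴴ * K * magicW) (fun i => ((v i : ℝ) : ℂ)) = v ⬝ᵥ M *ᵥ v :=
    quadForm_ofReal _ v
  rw [magicVector, quadForm_apply_smul, quadForm_mulVec, hreal, hnorm, hM, Matrix.add_mulVec,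
    dotProduct_add, Matrix.mulVec_transpose, dotProduct_comm v (v ᵥ* M),
    ← Matrix.dotProduct_mulVec, two_mul]

end MagicBasis

section Qubits

variable {F : MatrixMap (Fin 2)} {U : Matrix (Fin 2) (Fin 2) ℂ} {v : Fin 4 → ℝ}
  {K : Matrix (Fin 2 × Fin 2) (Fin 2 × Fin 2) ℂ}

theorem exists_vectorize_eq_smul_magicVector (hU : U ∈ Matrix.unitaryGroup (Fin 2) ℂ) :
    ∃ (c : ℂ) (v : Fin 4 → ℝ), ‖c‖ = 1 ∧ v ⬝ᵥ v = 1 ∧ vectorize U = c • magicVector v := by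
  obtain ⟨c, hc, V, hV, rfl⟩ := exists_eq_smul_mem_specialUnitaryGroup hU
  obtain ⟨v, hv, rfl⟩ := exists_eq_magicUnitary hV
  refine ⟨c, v, hc, hv, ?_⟩
  simpa [vectorize_eq_vec] using congrArg (c • ·) (vectorize_magicUnitary v)

theorem IsLeadingUnitEigenvector.quadForm_vectorize
    (hv : IsLeadingUnitEigenvector (magicSymm K) v) :
    quadForm K (vectorize (magicUnitary v)) = lambda1 (magicSymm K) := by
  rw [vectorize_magicUnitary, quadForm_magicVector,
    ((isLeadingUnitEigenvector_iff isHermitian_magicSymm).1 hv).2]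

theorem lambda1_magicSymm_pos (hK : K.PosDef) : 0 < lambda1 (magicSymm K) := by
  obtain ⟨v, hv⟩ := exists_isLeadingUnitEigenvector (isHermitian_magicSymm (K := K))
  rw [← hv.quadForm_vectorize]
  exact quadForm_vectorize_pos hK (magicUnitary_mem_unitaryGroup hv.1)

theorem IsLeadingUnitEigenvector.isOptimalUnitary
    (hv : IsLeadingUnitEigenvector (magicSymm (choi F)⁻¹) v) :
    IsOptimalUnitary F (magicUnitary v) := by
  refine ⟨magicUnitary_mem_unitaryGroup hv.1, fun V hV => ?_⟩
  obtain ⟨c, w, hc, hw, hVw⟩ := exists_vectorize_eq_smul_magicVector hV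
  simpa [hv.quadForm_vectorize, hVw, quadForm_apply_smul, hc, quadForm_magicVector] using
    dotProduct_mulVec_le_lambda1 isHermitian_magicSymm hw

theorem IsLeadingUnitEigenvector.unitaryWeight_eq
    (hv : IsLeadingUnitEigenvector (magicSymm (choi F)⁻¹) v) :
    unitaryWeight F (magicUnitary v) = 2 / lambda1 (magicSymm (choi F)⁻¹) := by
  rw [unitaryWeight, hv.quadForm_vectorize, Fintype.card_fin, Nat.cast_ofNat]

theorem IsOptimalUnitary.exists_isLeadingUnitEigenvector (hU : IsOptimalUnitary F U) :
    ∃ (c : ℂ) (v : Fin 4 → ℝ), ‖c‖ = 1 ∧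
      IsLeadingUnitEigenvector (magicSymm (choi F)⁻¹) v ∧ vectorize U = c • magicVector v := by
  have hsymm := isHermitian_magicSymm (K := (choi F)⁻¹)
  obtain ⟨c, v, hc, hv, hUv⟩ := exists_vectorize_eq_smul_magicVector hU.1
  obtain ⟨w, hw⟩ := QuantumChannel.exists_isLeadingUnitEigenvector hsymm
  refine ⟨c, v, hc, (isLeadingUnitEigenvector_iff hsymm).2 ⟨hv, ?_⟩, hUv⟩
  refine (dotProduct_mulVec_le_lambda1 hsymm hv).antisymm ?_
  simpa [hw.quadForm_vectorize, hUv, quadForm_apply_smul, hc, quadForm_magicVector] using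
    hU.2 (magicUnitary_mem_unitaryGroup hw.1)

end Qubits

end QuantumChannel

end

theorem mainTheorem8 (F : MatrixMap (Fin 2))
    (hF : F ∈ intrinsicInterior ℝ (channels (Fin 2))) :
    -- `W` is unitary and `J_F` is invertible
    magicWᴴ * magicW = 1 ∧ magicW * magicWᴴ = 1 ∧ IsUnit (choi F).det ∧
    -- the matrix `W† J_F⁻¹ W + (W† J_F⁻¹ W)ᵀ` is a real symmetric matrix `R`
    ∃ R : Matrix (Fin 4) (Fin 4) ℝ,
      R.map (fun r : ℝ => (r : ℂ)) =
        magicWᴴ * (choi F)⁻¹ * magicW + (magicWᴴ * (choi F)⁻¹ * magicW)ᵀ ∧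
      R.IsSymm ∧
      -- its largest eigenvalue exists, is positive, and gives the boundariness
      IsGreatest (realEigenvalues R) (lambda1 R) ∧ 0 < lambda1 R ∧
      boundariness (channels (Fin 2)) F = 2 / lambda1 R ∧
      -- `2 (1 - b(F))` bounds the base norm distance of `F` from every channel
      (∀ E ∈ channels (Fin 2),
        baseNorm (channels (Fin 2)) (F - E) ≤ 2 * (1 - boundariness (channels (Fin 2)) F)) ∧
      -- every leading eigenvector `v` yields a unitary channel at that distance, `|U⟩⟩ = √2 W v`
      (∀ v : Fin 4 → ℝ, IsLeadingUnitEigenvector R v →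
        ∃ U ∈ Matrix.unitaryGroup (Fin 2) ℂ, vectorize U = magicVector v ∧
          conjMap U ∈ channels (Fin 2) ∧
          baseNorm (channels (Fin 2)) (F - conjMap U) =
            2 * (1 - boundariness (channels (Fin 2)) F)) ∧
      -- and every unitary channel at that distance arises so (a global phase is immaterial)
      (∀ U ∈ Matrix.unitaryGroup (Fin 2) ℂ,
        baseNorm (channels (Fin 2)) (F - conjMap U) =
            2 * (1 - boundariness (channels (Fin 2)) F) →
        ∃ (c : ℂ) (v : Fin 4 → ℝ), ‖c‖ = 1 ∧ IsLeadingUnitEigenvector R v ∧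
          vectorize U = c • magicVector v) := by
  have hJ := choi_posDef hF
  obtain ⟨w, hw⟩ := exists_isLeadingUnitEigenvector (isHermitian_magicSymm (K := (choi F)⁻¹))
  have hopt := hw.isOptimalUnitary
  refine ⟨conjTranspose_magicW_mul_self, magicW_mul_conjTranspose_self,
    (Matrix.isUnit_iff_isUnit_det _).1 hJ.isUnit, magicSymm (choi F)⁻¹,
    map_ofReal_magicSymm hJ.inv.isHermitian, isSymm_magicSymm,
    isGreatest_lambda1 isHermitian_magicSymm, lambda1_magicSymm_pos hJ.inv,
    (hopt.boundariness_eq hF).trans hw.unitaryWeight_eq, fun E hE => hopt.baseNorm_sub_le hF hE,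
    fun v hv => ?_, fun U hU hnorm => ?_⟩
  · exact ⟨magicUnitary v, magicUnitary_mem_unitaryGroup hv.1, vectorize_magicUnitary v,
      conjMap_mem_channels (magicUnitary_mem_unitaryGroup hv.1),
      hv.isOptimalUnitary.baseNorm_sub_conjMap hF⟩
  · exact (hopt.of_baseNorm_sub_eq hF hU hnorm).exists_isLeadingUnitEigenvector
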